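/- **Corollary (at least $n$ bits of pairwise shared keys).** Let $n \ge 3$, and let $D$ be a set of data items with $|D| \ge 2$. Consider a classical protocol $P$ among $n$ players whose only resources are pairwise shared key bits, private randomness and public communication (a reliable broadcast channel; every message is seen by everybody). Thus there are finitely many independent uniform key bits, each known to exactly two distinct players (several bits may be shared by the same pair), and each player has private discrete randomness independent of everything else. In each of finitely many rounds the players, one after another, transmit one message, which is a function of the round, the player, the player's role (sender of $d \in D$, receiver, or neither), the randomness $G_i$ held by the player $i$ (the key bits he shares and his private randomness), and all earlier messages. Let $C$ denote the sequence of all messages. Suppose that: 1. (*Transmission*) for all players $s \ne r$ and every $d \in D$, if $s$ sends $d$, $r$ is the receiver and all players follow the protocol, then with probability $1$ the receiver $r$ obtains $d$, as a function of $G_r$ and $C$; 2. (*Sender anonymity, no colluding players*) for every set $E$ of at most one player, and every $d \in D$: if the sender $s$ is uniformly distributed over the players outside $E$, the receiver is uniformly distributed over the players other than $s$, and both are independent of the randomness of the run, then $$\max_S \mathrm{Prob}\bigl[S = s\bigr] = \frac{1}{n-|E|},$$ where the maximum is over all guesses $S$ that are functions of the messages $C$, the randomness $(G_i)_{i \in E}$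 held by the players in $E$, and the roles of the players in $E$. Then $P$ uses at least $n$ bits of pairwise shared keys. -/

import Mathlib

open scoped ENNReal

noncomputable section

/-- Total mass of a finite product of discrete probability distributions. -/
theorem tsum_prod_pmf : ∀ {n : ℕ} {α : Fin n → Type*} (μ : ∀ i, PMF (α i)),
    ∑' x : ∀ i, α i, ∏ i, μ i (x i) = 1
  | 0, α, μ => by simp
  | n + 1, α, μ => by
    rw [← (Fin.consEquiv α).tsum_eq, ENNReal.tsum_prod']
    simp only [Fin.consEquiv, Equiv.coe_fn_mk, Fin.prod_univ_succ, Fin.cons_zero, Fin.cons_succ]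
    simp only [ENNReal.tsum_mul_left]
    have h := tsum_prod_pmf (fun i : Fin n => μ i.succ)
    simp [h, PMF.tsum_coe]

/-- The joint distribution of finitely many independent discrete random variables. -/
def pmfPi {n : ℕ} {α : Fin n → Type*} (μ : ∀ i, PMF (α i)) : PMF (∀ i, α i) :=
  ⟨fun x => ∏ i, μ i (x i), (tsum_prod_pmf μ) ▸ ENNReal.summable.hasSum⟩

namespace AnonymousTransmission

/-- The role of a player in one run: the sender (who holds the data item to be sent),
the receiver, or neither of them. -/
inductive Role (D : Type*) where
  | sender (d : D)
  | receiver
  | neither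

/-- The role of player `i` when `s` sends the data item `d` and `r` is the receiver. -/
def roleOf {n : ℕ} {D : Type*} (s r : Fin n) (d : D) (i : Fin n) : Role D :=
  if i = s then .sender d else if i = r then .receiver else .neither

/-- A classical protocol among `n` players for transmitting data items from `D`, whose only
resources are pairwise shared key bits, private randomness of each player, and public
communication (every transmitted message is heard by everybody).

The key bits form the edges of the key-sharing graph: bit `b` is shared by exactly the two
distinct players in `keyEnds b`.  A pair of players may share no bit, one bit, or several. -/
structure Protocol.{u, v} (n : ℕ) (D : Type v) where
  /-- The total number of pairwise shared key bits. -/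
  numKeyBits : ℕ
  /-- The pair of players sharing a given key bit. -/
  keyEnds : Fin numKeyBits → Sym2 (Fin n)
  keyEnds_not_isDiag : ∀ b, ¬ (keyEnds b).IsDiag
  /-- The values of the private randomness of a player (the combined local randomness that the
  player generates over all rounds). -/
  Tape : Fin n → Type u
  /-- The distribution of the private randomness of a player. -/
  tapeLaw : ∀ i, PMF (Tape i)
  /-- The messages. -/
  Msg : Type u
  /-- The number of rounds. -/
  rounds : ℕ
  /-- The message transmitted by player `i` in a given round, as a function of the role of `i`
  (including the data item if `i` is the sender), of the randomness held by `i`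
  (the key bits that `i` shares with others, and the private randomness of `i`),
  and of the list of all earlier messages. -/
  message : Fin rounds → (i : Fin n) → Role D →
    ({b : Fin numKeyBits // i ∈ keyEnds b} → Bool) × Tape i → List Msg → Msg
  /-- The data item that player `i` outputs at the end in the role of the receiver, as a function
  of the randomness held by `i` and of the complete communication. -/
  output : (i : Fin n) →
    ({b : Fin numKeyBits // i ∈ keyEnds b} → Bool) × Tape i → List Msg → D

namespace Protocol

variable {n : ℕ} {D : Type*} (P : Protocol n D)

/-- The randomness held by player `i`: the key bits that `i` shares with other players, together
with the private randomness of `i`. -/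
abbrev Held (i : Fin n) : Type _ :=
  ({b : Fin P.numKeyBits // i ∈ P.keyEnds b} → Bool) × P.Tape i

/-- The randomness of a whole run: the values of all key bits and all private randomness. -/
abbrev Randomness : Type _ := (Fin P.numKeyBits → Bool) × (∀ i, P.Tape i)

/-- Key bits are independent and uniform; private randomness is independent of them and
independent across players. -/
def randomness : PMF P.Randomness :=
  (PMF.uniformOfFintype (Fin P.numKeyBits → Bool)).bind fun κ =>
    (pmfPi P.tapeLaw).map fun τ => (κ, τ)

/-- The part of the randomness that is held by player `i`. -/
def held (ω : P.Randomness) (i : Fin n) : P.Held i :=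
  (fun b => ω.1 b.1, ω.2 i)

/-- The turns of the protocol in temporal order: in each round the players `0, …, n - 1` transmit
one message each, one after another. -/
def schedule : List (Fin P.rounds × Fin n) :=
  (List.finRange P.rounds).product (List.finRange n)

/-- The sequence of all messages transmitted when the players have the given roles and the
randomness is `ω`. -/
def communication (roles : Fin n → Role D) (ω : P.Randomness) : List P.Msg :=
  P.schedule.foldl
    (fun earlier jm =>
      earlier ++ [P.message jm.1 jm.2 (roles jm.2) (P.held ω jm.2) earlier]) []

/-- Whenever all players follow the protocol, the receiver obtains (with probability one) the data
item that was sent, for all distinct players `s` (sender) and `r` (receiver) and all data items. -/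
def Delivers : Prop :=
  ∀ (s r : Fin n) (d : D), s ≠ r → ∀ ω ∈ P.randomness.support,
    P.output r (P.held ω r) (P.communication (roleOf s r d) ω) = d

/-- What an adversary who corrupts the players in `E` and monitors all transmissions may see:
the randomness held by the corrupted players, their roles, and all messages. -/
abbrev View (E : Finset (Fin n)) : Type _ :=
  (∀ i : E, P.Held i) × (E → Role D) × List P.Msg

/-- The adversary's view in the run with sender `s`, receiver `r`, data item `d` and
randomness `ω`. -/
def view (E : Finset (Fin n)) (s r : Fin n) (d : D) (ω : P.Randomness) : P.View E :=
  (fun i => P.held ω i, fun i => roleOf s r d i, P.communication (roleOf s r d) ω)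

/-- The possible pairs (sender, receiver): distinct players, with an uncorrupted sender. -/
def senderReceiverPairs (E : Finset (Fin n)) : Finset (Fin n × Fin n) :=
  Finset.univ.filter fun p => p.1 ∉ E ∧ p.1 ≠ p.2

/-- The probability that the guess `S`, which is a function of the view of an adversary corrupting
`E`, equals the sender of the data item `d`, where the pair (sender, receiver) is uniformly
distributed over the possible pairs (so that the sender is uniformly distributed over the
uncorrupted players) and independent of the randomness of the run. -/
def guessProb (E : Finset (Fin n)) (d : D) (S : P.View E → Fin n) : ℝ≥0∞ :=
  (∑ p ∈ senderReceiverPairs E,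
      P.randomness.toOuterMeasure {ω | S (P.view E p.1 p.2 d ω) = p.1}) /
    (senderReceiverPairs E).card

/-- Sender anonymity against any (passive) adversary corrupting at most `t` players: for every
data item, the maximal probability of guessing the sender from the view of the adversary is the a
priori probability `1 / (n - |E|)`, where `E` is the set of corrupted players, `|E| ≤ n - 2`. -/
def SenderAnonymous (t : ℕ) : Prop :=
  ∀ E : Finset (Fin n), E.card ≤ t → E.card + 2 ≤ n → ∀ d : D,
    IsGreatest (Set.range (P.guessProb E d)) (((n - E.card : ℕ) : ℝ≥0∞)⁻¹)

end Protocol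

end AnonymousTransmission

end

/-! Each player must share at least two key bits; the handshake count then gives `n` bits. Otherwise
some `j ≠ i` holds all key bits of `i`. Let `j` be the receiver and let `L` be the law of what `j`
holds and hears. Given this observation, the private randomness of `i` is independent of everything
else, so `i`'s tape and role can be exchanged together between two runs that look alike to `j`
(`observationLaw_mul_exchange`). For a third player `k`, this gives pointwise `L(i sends) * L(k
sends) = L(nobody sends) * L(both send)`. Anonymity against `j` forces `L(i sends) = L(k sends)`
(`observationLaw_roleOf_le`), so `L(i sends)` is the geometric mean of two probability laws and
hence, by equality in AM-GM, equals `L(nobody sends)`. That law does not involve the data item, so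
`j` cannot recover it. -/

/-- Two probability mass functions whose geometric mean is again a probability mass function
coincide with that mean. -/
theorem PMF.eq_of_mul_eq_mul_self {α : Type*} (μ ρ ν : PMF α)
    (h : ∀ a, μ a * ρ a = ν a * ν a) : ν = μ := by
  have hsum (p : PMF α) : HasSum (fun a => (p a).toReal) 1 := by
    have h := ENNReal.hasSum_toReal (f := fun a => p a) (by simp [p.tsum_coe])
    rwa [← ENNReal.tsum_toReal_eq p.apply_ne_top, p.tsum_coe, ENNReal.toReal_one] at h
  have hmul (a : α) : (μ a).toReal * (ρ a).toReal = (ν a).toReal * (ν a).toReal := by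
    simpa using congrArg ENNReal.toReal (h a)
  -- AM-GM makes every term nonnegative, and the total is `1 + 1 - 2`, so every term vanishes.
  have hdiff : HasSum (fun a => (μ a).toReal + (ρ a).toReal - 2 * (ν a).toReal) 0 := by
    have h := ((hsum μ).add (hsum ρ)).sub ((hsum ν).mul_left 2)
    rwa [show (1 + 1 - 2 * 1 : ℝ) = 0 by norm_num] at h
  have hnonneg (a : α) : 0 ≤ (μ a).toReal + (ρ a).toReal - 2 * (ν a).toReal := by
    have hμ : 0 ≤ (μ a).toReal := ENNReal.toReal_nonneg
    have hρ : 0 ≤ (ρ a).toReal := ENNReal.toReal_nonneg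
    have : 2 * (ν a).toReal ≤ (μ a).toReal + (ρ a).toReal :=
      pow_le_pow_iff_left₀ (by positivity) (by positivity) two_ne_zero |>.1
        (by nlinarith [hmul a, sq_nonneg ((μ a).toReal - (ρ a).toReal)])
    linarith
  have hzero := (hasSum_zero_iff_of_nonneg hnonneg).1 hdiff
  ext a
  have ha : (μ a).toReal + (ρ a).toReal - 2 * (ν a).toReal = 0 := congrFun hzero a
  refine (ENNReal.toReal_eq_toReal_iff' (ν.apply_ne_top a) (μ.apply_ne_top a)).1 ?_
  have : ((ν a).toReal - (μ a).toReal) ^ 2 = 0 := by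
    have hρ : (ρ a).toReal = 2 * (ν a).toReal - (μ a).toReal := by linarith
    have := hmul a
    rw [hρ] at this
    linarith
  exact sub_eq_zero.1 (pow_eq_zero_iff two_ne_zero |>.1 this)

theorem pmfPi_apply {n : ℕ} {α : Fin n → Type*} (μ : ∀ i, PMF (α i)) (x : ∀ i, α i) :
    pmfPi μ x = ∏ i, μ i (x i) :=
  rfl

/-- Exchanging one coordinate between two samples preserves their joint probability. -/
theorem pmfPi_update_mul_update {n : ℕ} {α : Fin n → Type*} (μ : ∀ i, PMF (α i)) (i : Fin n)
    (x y : ∀ i, α i) :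
    pmfPi μ (Function.update x i (y i)) * pmfPi μ (Function.update y i (x i)) =
      pmfPi μ x * pmfPi μ y := by
  simp only [pmfPi_apply, ← Finset.prod_mul_distrib]
  refine Finset.prod_congr rfl fun l _ => ?_
  by_cases hl : l = i
  · subst hl
    simp [mul_comm]
  · simp [Function.update_of_ne hl]

/-! ### Degrees in the key-sharing graph -/

/-- If every vertex has degree at least two, there are at least as many edges as vertices. -/
theorem card_le_card_of_two_le_degree {V B : Type*} [Fintype V] [DecidableEq V] [Fintype B]
    (ends : B → Sym2 V) (h : ∀ v, 2 ≤ (Finset.univ.filter fun b => v ∈ ends b).card) :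
    Fintype.card V ≤ Fintype.card B := by
  have hB (b : B) : (Finset.univ.filter fun v => v ∈ ends b).card ≤ 2 := by
    induction hb : ends b with
    | _ x y =>
      refine (Finset.card_le_card (t := {x, y}) fun v hv => ?_).trans Finset.card_le_two
      simpa using hv
  have hcount : ∑ v, (Finset.univ.filter fun b => v ∈ ends b).card =
      ∑ b, (Finset.univ.filter fun v => v ∈ ends b).card := by
    simp only [Finset.card_filter]
    exact Finset.sum_comm
  have hlow := Finset.card_nsmul_le_sum Finset.univ
    (fun v => (Finset.univ.filter fun b => v ∈ ends b).card) 2 fun v _ => h v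
  have hup := Finset.sum_le_card_nsmul Finset.univ
    (fun b => (Finset.univ.filter fun v => v ∈ ends b).card) 2 fun b _ => hB b
  simp only [Finset.card_univ, smul_eq_mul] at hlow hup
  omega

/-- A vertex of degree at most one shares all of its edges with a single other vertex. -/
theorem exists_ne_forall_mem_of_degree_lt_two {V B : Type*} [Nontrivial V] [DecidableEq V]
    [Fintype B] (ends : B → Sym2 V) (hends : ∀ b, ¬ (ends b).IsDiag) (i : V)
    (h : (Finset.univ.filter fun b => i ∈ ends b).card < 2) :
    ∃ j, j ≠ i ∧ ∀ b, i ∈ ends b → j ∈ ends b := by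
  by_cases hex : ∃ b, i ∈ ends b
  · obtain ⟨b, hb⟩ := hex
    refine ⟨Sym2.Mem.other hb, Sym2.other_ne (hends b) hb, fun b' hb' => ?_⟩
    have : b' = b := Finset.card_le_one.1 (Nat.lt_succ_iff.1 h) b' (by simpa) b (by simpa)
    exact this ▸ Sym2.other_mem hb
  · obtain ⟨j, hj⟩ := exists_ne i
    exact ⟨j, hj, fun b hb => (hex ⟨b, hb⟩).elim⟩

namespace AnonymousTransmission

namespace Protocol

variable {n : ℕ} {D : Type*} (P : Protocol n D)

/-! ### Exchanging private randomness between runs -/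

theorem randomness_apply (ω : P.Randomness) :
    P.randomness ω =
      PMF.uniformOfFintype (Fin P.numKeyBits → Bool) ω.1 * pmfPi P.tapeLaw ω.2 := by
  classical
  obtain ⟨κ, τ⟩ := ω
  rw [randomness, PMF.bind_apply, tsum_eq_single κ]
  · rw [PMF.map_apply, tsum_eq_single τ]
    · simp
    · intro τ' hτ
      simp [hτ.symm]
  · intro κ' hκ
    have : ∀ τ', ¬ ((κ, τ) = (κ', τ')) := fun τ' h => hκ (congrArg Prod.fst h).symm
    simp [PMF.map_apply, this]

/-- The randomness of a run in which player `i` uses the private randomness from another run. -/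
def replaceTape (i : Fin n) (ω ω' : P.Randomness) : P.Randomness :=
  (ω.1, Function.update ω.2 i (ω'.2 i))

theorem randomness_replaceTape_mul (i : Fin n) (ω ω' : P.Randomness) :
    P.randomness (P.replaceTape i ω ω') * P.randomness (P.replaceTape i ω' ω) =
      P.randomness ω * P.randomness ω' := by
  simp only [randomness_apply, replaceTape, PMF.uniformOfFintype_apply]
  rw [mul_mul_mul_comm, pmfPi_update_mul_update, mul_mul_mul_comm]

/-- Exchanging the private randomness of player `i` between two runs. -/
def swapTape (i : Fin n) : P.Randomness × P.Randomness ≃ P.Randomness × P.Randomness :=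
  Function.Involutive.toPerm
    (fun p => (P.replaceTape i p.1 p.2, P.replaceTape i p.2 p.1))
    (fun p => by simp [replaceTape])

theorem held_replaceTape_of_ne {i l : Fin n} (hl : l ≠ i) (ω ω' : P.Randomness) :
    P.held (P.replaceTape i ω ω') l = P.held ω l := by
  simp [held, replaceTape, Function.update_of_ne hl]

/-- If player `j` holds all key bits of player `i`, then what `i` holds is determined by what `j`
holds and by the private randomness of `i`. -/
theorem held_replaceTape_self {i j : Fin n} (hij : ∀ b, i ∈ P.keyEnds b → j ∈ P.keyEnds b)
    {ω ω' : P.Randomness} (h : P.held ω j = P.held ω' j) :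
    P.held (P.replaceTape i ω ω') i = P.held ω' i := by
  refine Prod.ext (funext fun b => ?_) (by simp [held, replaceTape])
  exact congrFun (congrArg Prod.fst h) ⟨b.1, hij b.1 b.2⟩

/-! ### Mixing runs with equal transcripts -/

theorem prefix_foldl_append {α β : Type*} (f : β → List α → α) (l : List β) (acc : List α) :
    acc <+: l.foldl (fun acc b => acc ++ [f b acc]) acc := by
  induction l generalizing acc with
  | nil => exact List.prefix_rfl
  | cons b l ih => exact (List.prefix_append _ _).trans (ih _)

/-- If two message sequences generated step by step coincide, then so does every sequence in which
each step is taken from one of the two. -/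
theorem foldl_append_eq_of_mix {α β : Type*} (f g m : β → List α → α)
    (hm : ∀ b, m b = f b ∨ m b = g b) (l : List β) (acc c : List α)
    (hf : l.foldl (fun acc b => acc ++ [f b acc]) acc = c)
    (hg : l.foldl (fun acc b => acc ++ [g b acc]) acc = c) :
    l.foldl (fun acc b => acc ++ [m b acc]) acc = c := by
  induction l generalizing acc with
  | nil => exact hf
  | cons b l ih =>
    simp only [List.foldl_cons] at hf hg ⊢
    -- Both sides are prefixes of `c` of the same length.
    have hfg : acc ++ [f b acc] = acc ++ [g b acc] :=
      (List.prefix_of_prefix_length_le (hf ▸ prefix_foldl_append f l _)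
        (hg ▸ prefix_foldl_append g l _) (by simp)).eq_of_length (by simp)
    have hmf : acc ++ [m b acc] = acc ++ [f b acc] := by
      rcases hm b with h | h <;> rw [h]
      exact hfg.symm
    rw [hmf]
    exact ih _ hf (hfg ▸ hg)

/-- The rectangle property of communication protocols: each message depends only on its sender's
role and randomness and on the past. -/
theorem communication_eq_of_mix {ρ ρ' σ : Fin n → Role D} {ω ω' χ : P.Randomness}
    (h : ∀ l, (σ l = ρ l ∧ P.held χ l = P.held ω l) ∨
      (σ l = ρ' l ∧ P.held χ l = P.held ω' l))
    {c : List P.Msg} (hc : P.communication ρ ω = c) (hc' : P.communication ρ' ω' = c) :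
    P.communication σ χ = c :=
  foldl_append_eq_of_mix
    (fun (jm : Fin P.rounds × Fin n) => P.message jm.1 jm.2 (ρ jm.2) (P.held ω jm.2))
    (fun (jm : Fin P.rounds × Fin n) => P.message jm.1 jm.2 (ρ' jm.2) (P.held ω' jm.2))
    (fun (jm : Fin P.rounds × Fin n) => P.message jm.1 jm.2 (σ jm.2) (P.held χ jm.2))
    (fun jm => by
      rcases h jm.2 with ⟨h₁, h₂⟩ | ⟨h₁, h₂⟩
      · exact Or.inl (by rw [h₁, h₂])
      · exact Or.inr (by rw [h₁, h₂]))
    P.schedule [] c hc hc'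

/-! ### The receiver's observation -/

/-- The randomness held by player `j` together with the communication, for given roles. -/
def observation (j : Fin n) (ρ : Fin n → Role D) (ω : P.Randomness) :
    P.Held j × List P.Msg :=
  (P.held ω j, P.communication ρ ω)

/-- Exchanging the private randomness of `i`, along with the role of `i`, between two runs that look
the same to a player `j` who holds all key bits of `i` does not change what `j` sees. -/
theorem observation_replaceTape {i j : Fin n} (hji : j ≠ i)
    (hij : ∀ b, i ∈ P.keyEnds b → j ∈ P.keyEnds b) {ρ ρ' σ : Fin n → Role D}
    (hσi : σ i = ρ' i) (hσ : ∀ l, l ≠ i → σ l = ρ l)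
    {ω ω' : P.Randomness} {v : P.Held j × List P.Msg}
    (h : P.observation j ρ ω = v) (h' : P.observation j ρ' ω' = v) :
    P.observation j σ (P.replaceTape i ω ω') = v := by
  subst h
  have hheld : P.held ω j = P.held ω' j := (congrArg Prod.fst h').symm
  refine Prod.ext (P.held_replaceTape_of_ne hji ω ω') ?_
  refine P.communication_eq_of_mix (ρ := ρ) (ρ' := ρ') (ω := ω) (ω' := ω') (fun l => ?_) rfl
    (congrArg Prod.snd h')
  by_cases hl : l = i
  · subst hl
    exact Or.inr ⟨hσi, P.held_replaceTape_self hij hheld⟩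
  · exact Or.inl ⟨hσ l hl, P.held_replaceTape_of_ne hl ω ω'⟩

/-- The distribution of what player `j` observes, for given roles. -/
noncomputable def observationLaw (j : Fin n) (ρ : Fin n → Role D) : PMF (P.Held j × List P.Msg) :=
  P.randomness.map (P.observation j ρ)

-- Expresses the product as a sum over two independent runs, to be reindexed by `swapTape`.
open Classical in
theorem observationLaw_mul (j : Fin n) (ρ ρ' : Fin n → Role D) (v : P.Held j × List P.Msg) :
    P.observationLaw j ρ v * P.observationLaw j ρ' v =
      ∑' p : P.Randomness × P.Randomness,
        if P.observation j ρ p.1 = v ∧ P.observation j ρ' p.2 = v then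
          P.randomness p.1 * P.randomness p.2 else 0 := by
  simp only [observationLaw, PMF.map_apply]
  refine Eq.trans ?_ ENNReal.tsum_prod'.symm
  refine ENNReal.tsum_mul_right.symm.trans (tsum_congr fun ω => ?_)
  refine ENNReal.tsum_mul_left.symm.trans (tsum_congr fun ω' => ?_)
  by_cases h : P.observation j ρ ω = v <;> by_cases h' : P.observation j ρ' ω' = v <;>
    simp [h, h', eq_comm (a := v)]

/-- If `j` holds all key bits of `i`, then the role of `i` can be exchanged between two runs. -/
theorem observationLaw_mul_exchange {i j : Fin n} (hji : j ≠ i)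
    (hij : ∀ b, i ∈ P.keyEnds b → j ∈ P.keyEnds b) {ρ ρ' σ σ' : Fin n → Role D}
    (hσi : σ i = ρ' i) (hσ : ∀ l, l ≠ i → σ l = ρ l)
    (hσi' : σ' i = ρ i) (hσ' : ∀ l, l ≠ i → σ' l = ρ' l) (v : P.Held j × List P.Msg) :
    P.observationLaw j ρ v * P.observationLaw j ρ' v =
      P.observationLaw j σ v * P.observationLaw j σ' v := by
  classical
  rw [observationLaw_mul, observationLaw_mul, ← (P.swapTape i).tsum_eq
    (fun p : P.Randomness × P.Randomness =>
      if P.observation j ρ p.1 = v ∧ P.observation j ρ' p.2 = v then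
        P.randomness p.1 * P.randomness p.2 else 0)]
  refine tsum_congr fun p => ?_
  obtain ⟨ω, ω'⟩ := p
  change (if P.observation j ρ (P.replaceTape i ω ω') = v ∧
    P.observation j ρ' (P.replaceTape i ω' ω) = v then
      P.randomness (P.replaceTape i ω ω') * P.randomness (P.replaceTape i ω' ω) else 0) = _
  rw [randomness_replaceTape_mul]
  refine if_congr ⟨fun ⟨h, h'⟩ => ?_, fun ⟨h, h'⟩ => ?_⟩ rfl rfl
  · have h₁ := P.observation_replaceTape hji hij hσi hσ h h'
    have h₂ := P.observation_replaceTape hji hij hσi' hσ' h' h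
    simpa [replaceTape] using And.intro h₁ h₂
  · exact ⟨P.observation_replaceTape hji hij hσi'.symm (fun l hl => (hσ l hl).symm) h h',
      P.observation_replaceTape hji hij hσi.symm (fun l hl => (hσ' l hl).symm) h' h⟩

/-! ### Consequences of anonymity -/

theorem card_senderReceiverPairs_fiber {j s : Fin n} (hs : s ≠ j) :
    ((senderReceiverPairs {j}).filter fun p => p.1 = s).card = n - 1 := by
  have : ((senderReceiverPairs {j}).filter fun p => p.1 = s) =
      (Finset.univ.erase s).image fun r => (s, r) := by
    ext ⟨a, b⟩
    simp only [senderReceiverPairs, Finset.mem_filter, Finset.mem_univ, true_and,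
      Finset.mem_singleton, Finset.mem_image, Finset.mem_erase, and_true, Prod.mk.injEq]
    constructor
    · rintro ⟨⟨-, h⟩, rfl⟩
      exact ⟨b, h.symm, rfl, rfl⟩
    · rintro ⟨r, hr, rfl, rfl⟩
      exact ⟨⟨hs, hr.symm⟩, rfl⟩
  rw [this, Finset.card_image_of_injective _ (Prod.mk_right_injective s),
    Finset.card_erase_of_mem (Finset.mem_univ _), Finset.card_univ, Fintype.card_fin]

theorem card_senderReceiverPairs (j : Fin n) :
    (senderReceiverPairs {j}).card = (n - 1) * (n - 1) := by
  rw [Finset.card_eq_sum_card_fiberwise (f := Prod.fst) (t := Finset.univ.erase j)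
    (fun p hp => by simp [senderReceiverPairs] at hp ⊢; exact hp.1)]
  rw [Finset.sum_congr rfl fun s hs =>
    card_senderReceiverPairs_fiber (Finset.ne_of_mem_erase hs)]
  simp

/-- There are `(n - 1)²` equally likely pairs and the success probability is at most `1 / (n - 1)`.
-/
theorem sum_guess_le (hn : 3 ≤ n) (hanonymous : P.SenderAnonymous 1) (j : Fin n) (d : D)
    (S : P.View {j} → Fin n) :
    ∑ p ∈ senderReceiverPairs {j},
      P.randomness.toOuterMeasure {ω | S (P.view {j} p.1 p.2 d ω) = p.1} ≤ (n - 1 : ℕ) := by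
  have h := (hanonymous {j} (by simp) (by simpa using hn) d).2 ⟨S, rfl⟩
  have h0 : ((n - 1 : ℕ) : ℝ≥0∞) ≠ 0 := by
    rw [Nat.cast_ne_zero]
    omega
  have htop : ((n - 1 : ℕ) : ℝ≥0∞) ≠ ⊤ := ENNReal.natCast_ne_top _
  rw [guessProb, card_senderReceiverPairs, Finset.card_singleton, Nat.cast_mul,
    ENNReal.div_le_iff (mul_ne_zero h0 h0) (ENNReal.mul_ne_top htop htop), ← mul_assoc,
    ENNReal.inv_mul_cancel h0 htop, one_mul] at h
  exact h

theorem observationLaw_apply (j : Fin n) (ρ : Fin n → Role D) (v : P.Held j × List P.Msg) :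
    P.observationLaw j ρ v = P.randomness.toOuterMeasure {ω | P.observation j ρ ω = v} := by
  rw [← PMF.toOuterMeasure_apply_singleton, observationLaw, PMF.toOuterMeasure_map_apply]
  rfl

/-- The guess `s₁` on views in which `j` is the receiver and observes `v`, and `s₀` otherwise. -/
noncomputable def testGuess (j s₀ s₁ : Fin n) (v : P.Held j × List P.Msg)
    (w : P.View {j}) : Fin n :=
  open Classical in
  if w.2.1 ⟨j, Finset.mem_singleton_self j⟩ = Role.receiver ∧
    (w.1 ⟨j, Finset.mem_singleton_self j⟩, w.2.2) = v then s₁ else s₀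

theorem testGuess_view_receiver {j s : Fin n} (hs : s ≠ j) (s₀ s₁ : Fin n)
    (v : P.Held j × List P.Msg) (d : D) (ω : P.Randomness)
    [Decidable (P.observation j (roleOf s j d) ω = v)] :
    P.testGuess j s₀ s₁ v (P.view {j} s j d ω) =
      if P.observation j (roleOf s j d) ω = v then s₁ else s₀ := by
  have hrole : roleOf s j d j = Role.receiver := by simp [roleOf, hs.symm]
  classical
  exact if_congr (by simp [view, observation, hrole]) rfl rfl

theorem testGuess_view_neither {j s r : Fin n} (hs : s ≠ j) (hr : r ≠ j) (s₀ s₁ : Fin n)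
    (v : P.Held j × List P.Msg) (d : D) (ω : P.Randomness) :
    P.testGuess j s₀ s₁ v (P.view {j} s r d ω) = s₀ := by
  simp [testGuess, view, roleOf, hs.symm, hr.symm]

/-- Sender anonymity against player `j`, in the role of the receiver. -/
theorem observationLaw_roleOf_le (hn : 3 ≤ n) (hanonymous : P.SenderAnonymous 1)
    {j s₀ s₁ : Fin n} (h₀ : s₀ ≠ j) (h₁ : s₁ ≠ j) (hne : s₁ ≠ s₀) (d : D)
    (v : P.Held j × List P.Msg) :
    P.observationLaw j (roleOf s₁ j d) v ≤ P.observationLaw j (roleOf s₀ j d) v := by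
  classical
  set f : Fin n × Fin n → ℝ≥0∞ := fun p => P.randomness.toOuterMeasure
    {ω | P.testGuess j s₀ s₁ v (P.view {j} p.1 p.2 d ω) = p.1} with hf
  set T := (senderReceiverPairs {j}).filter fun p => p.1 = s₀ with hT
  have hle : ∑ p ∈ senderReceiverPairs {j}, f p ≤ (n - 1 : ℕ) :=
    P.sum_guess_le hn hanonymous j d _
  have hf₁ : f (s₁, j) = P.observationLaw j (roleOf s₁ j d) v := by
    rw [observationLaw_apply, hf]
    refine congrArg P.randomness.toOuterMeasure (Set.ext fun ω => ?_)
    rw [Set.mem_ofPred_eq, Set.mem_ofPred_eq, P.testGuess_view_receiver h₁]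
    split_ifs with h <;> simp [h, hne.symm]
  have huniv : P.randomness.toOuterMeasure Set.univ = 1 :=
    (PMF.toOuterMeasure_apply_eq_one_iff _ _).2 (Set.subset_univ _)
  -- Always guessing `s₀` already attains the bound `n - 1`. Switching to `s₁` at `v` loses only the
  -- `s₀`-mass of `v` and gains its `s₁`-mass, so the gain cannot exceed the loss.
  have hf₀ : ∀ p ∈ T, 1 ≤ f p +
      if p = (s₀, j) then P.observationLaw j (roleOf s₀ j d) v else 0 := by
    rintro ⟨s, r⟩ hp
    obtain rfl : s = s₀ := (Finset.mem_filter.1 hp).2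
    by_cases hr : r = j
    · subst hr
      rw [if_pos rfl, observationLaw_apply, ← huniv]
      refine le_trans (MeasureTheory.measure_mono fun ω _ => ?_)
        (MeasureTheory.measure_union_le _ _)
      by_cases h : P.observation r (roleOf s r d) ω = v
      · exact Or.inr h
      · refine Or.inl ?_
        rw [Set.mem_ofPred_eq, P.testGuess_view_receiver h₀, if_neg h]
    · refine le_add_right (huniv ▸ MeasureTheory.measure_mono fun ω _ => ?_)
      exact P.testGuess_view_neither h₀ hr _ _ _ _ _
  have hmem₀ : (s₀, j) ∈ T := by simp [hT, senderReceiverPairs, h₀]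
  have hcard : ((n - 1 : ℕ) : ℝ≥0∞) ≤
      ∑ p ∈ T, f p + P.observationLaw j (roleOf s₀ j d) v := by
    have h := Finset.sum_le_sum hf₀
    rw [Finset.sum_add_distrib, Finset.sum_ite_eq' T, if_pos hmem₀, Finset.sum_const,
      card_senderReceiverPairs_fiber h₀, nsmul_eq_mul, mul_one] at h
    exact h
  have hsub : ∑ p ∈ T, f p + f (s₁, j) ≤ ∑ p ∈ senderReceiverPairs {j}, f p := by
    rw [add_comm, ← Finset.sum_insert (by simp [hT, hne])]
    refine Finset.sum_le_sum_of_subset (Finset.insert_subset ?_ (Finset.filter_subset _ _))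
    simp [senderReceiverPairs, h₁]
  refine (ENNReal.add_le_add_iff_left (ENNReal.natCast_ne_top (n - 1))).1 ?_
  calc ((n - 1 : ℕ) : ℝ≥0∞) + P.observationLaw j (roleOf s₁ j d) v
      ≤ ∑ p ∈ T, f p + P.observationLaw j (roleOf s₀ j d) v + f (s₁, j) := by
        rw [hf₁]
        gcongr
    _ = (∑ p ∈ T, f p + f (s₁, j)) + P.observationLaw j (roleOf s₀ j d) v := add_right_comm _ _ _
    _ ≤ ((n - 1 : ℕ) : ℝ≥0∞) + P.observationLaw j (roleOf s₀ j d) v := by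
        gcongr
        exact hsub.trans hle

/-! ### Contradiction with delivery -/

/-- If `j` holds all key bits of `i`, then the observation of the receiver `j` when `i` is the
sender is distributed as if nobody were sending. -/
theorem observationLaw_roleOf_eq (hn : 3 ≤ n) (hanonymous : P.SenderAnonymous 1) {i j : Fin n}
    (hji : j ≠ i) (hij : ∀ b, i ∈ P.keyEnds b → j ∈ P.keyEnds b) (d : D) :
    P.observationLaw j (roleOf i j d) =
      P.observationLaw j fun l => if l = j then Role.receiver else Role.neither := by
  obtain ⟨k, hk⟩ : ∃ k, k ∉ ({i, j} : Finset (Fin n)) := by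
    by_contra! h
    have := Finset.card_le_card (Finset.subset_iff.2 fun k (_ : k ∈ Finset.univ) => h k)
    rw [Finset.card_univ, Fintype.card_fin] at this
    exact absurd (this.trans Finset.card_le_two) (by omega)
  simp only [Finset.mem_insert, Finset.mem_singleton, not_or] at hk
  obtain ⟨hki, hkj⟩ := hk
  have hik : P.observationLaw j (roleOf i j d) = P.observationLaw j (roleOf k j d) :=
    PMF.ext fun v => le_antisymm
      (P.observationLaw_roleOf_le hn hanonymous hkj hji.symm (Ne.symm hki) d v)
      (P.observationLaw_roleOf_le hn hanonymous hji.symm hkj hki d v)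
  -- The second law belongs to a fictitious run in which both `i` and `k` send; it is meaningful
  -- because messages are defined for arbitrary roles.
  refine PMF.eq_of_mul_eq_mul_self _
    (P.observationLaw j fun l => if l = i then Role.sender d else roleOf k j d l) _ fun v => ?_
  nth_rw 2 [hik]
  refine P.observationLaw_mul_exchange hji hij ?_ ?_ ?_ ?_ v
  · simp [roleOf]
  · intro l hl
    simp [roleOf, hl]
  · simp [roleOf, hji.symm, Ne.symm hki]
  · intro l hl
    simp [hl]

/-- No player other than `i` holds all key bits of `i`. -/
theorem exists_keyEnds_not_mem [Nontrivial D] (hn : 3 ≤ n) (hdelivers : P.Delivers)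
    (hanonymous : P.SenderAnonymous 1) {i j : Fin n} (hji : j ≠ i) :
    ∃ b, i ∈ P.keyEnds b ∧ j ∉ P.keyEnds b := by
  by_contra! hij
  obtain ⟨d, d', hd⟩ := exists_pair_ne D
  have hlaw : P.observationLaw j (roleOf i j d) = P.observationLaw j (roleOf i j d') :=
    (P.observationLaw_roleOf_eq hn hanonymous hji hij d).trans
      (P.observationLaw_roleOf_eq hn hanonymous hji hij d').symm
  obtain ⟨ω, hω⟩ := P.randomness.support_nonempty
  have hv : P.observation j (roleOf i j d) ω ∈ (P.observationLaw j (roleOf i j d)).support :=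
    (PMF.mem_support_map_iff _ _ _).2 ⟨ω, hω, rfl⟩
  -- An observation possible under `d` is possible under `d'`, yet it determines the output.
  rw [hlaw] at hv
  obtain ⟨ω', hω', h⟩ := (PMF.mem_support_map_iff _ _ _).1 hv
  apply hd
  rw [← hdelivers i j d hji.symm ω hω, ← hdelivers i j d' hji.symm ω' hω']
  exact congrArg (fun v => P.output j v.1 v.2) h.symm

end Protocol

end AnonymousTransmission

theorem mainTheorem4 {n : ℕ} (hn : 3 ≤ n) {D : Type*} [Nontrivial D]
    (P : AnonymousTransmission.Protocol n D)
    (hdelivers : P.Delivers) (hanonymous : P.SenderAnonymous 1) :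
    n ≤ P.numKeyBits := by
  have : Nontrivial (Fin n) := Fin.nontrivial_iff_two_le.2 (by omega)
  have h := card_le_card_of_two_le_degree P.keyEnds fun i => by
    by_contra! hi
    obtain ⟨j, hji, hij⟩ :=
      exists_ne_forall_mem_of_degree_lt_two P.keyEnds P.keyEnds_not_isDiag i hi
    obtain ⟨b, hib, hjb⟩ := P.exists_keyEnds_not_mem hn hdelivers hanonymous hji
    exact hjb (hij b hib)
  simpa using h
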